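/- Let $k$ be a commutative integral domain and $X$ a non-empty set. Let $\mathfrak M(X)$ be the free operated monoid on $X$, i.e. the monoid (under concatenation) of bracketed words: the finite sequences, including the empty word $1$, of elements of $X\sqcup\lfloor \mathfrak M(X)\rfloor$, with operator $u\mapsto\lfloor u\rfloor$. For $u\in\mathfrak M(X)$ the breadth $|u|$ is the number of its factors in $X\sqcup\lfloor \mathfrak M(X)\rfloor$. Let $k\mathfrak M(X)$ be the monoid algebra, with the operator extended linearly. Let $\mathfrak M^\star(X)$ be the set of bracketed words on $X\sqcup\{\star\}$ in which $\star$ occurs exactly once; for $q\in\mathfrak M^\star(X)$ and $u\in\mathfrak M(X)$ let $q|_u$ be the word obtained from $q$ by replacing $\star$ by $u$, and extend $q|_u$ linearly to $q|_s$ for $s\in k\mathfrak M(X)$. Let $\le$ be a monomial order on $\mathfrak M(X)$, that is, a well-order such that $u<v$ implies $q|_u<q|_v$ for all $q\in\mathfrak M^\star(X)$. For $s\in k\mathfrak M(X)\setminus k$ let $\bar s$ be the largest monomial appearing in $s$ (for $s \in k$ put $\bar s=1$), let $c_s$ be the coefficient of $\bar s$ in $s$, and let $R(s)=c_s\bar s-s$.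 Let $S\subseteq k\mathfrak M(X)$ be monic, i.e. $s\notin k$ and $c_s=1$ for every $s\in S$. Put $$\Pi_S=\{\,q|_{\bar s}\to q|_{R(s)} \mid s\in S,\ q\in\mathfrak M^\star(X)\,\},\qquad \mathrm{Irr}(S)=\mathfrak M(X)\setminus\{\,q|_{\bar s}\mid s\in S,\ q\in\mathfrak M^\star(X)\,\},$$ let $k\,\mathrm{Irr}(S)$ be the $k$-span of $\mathrm{Irr}(S)$, and let $\mathrm{Id}(S)$ be the smallest two-sided ideal of $k\mathfrak M(X)$ that contains $S$ and is closed under $\lfloor\ \rfloor$. The system $\Pi_S$ rewrites $f$ to $g$ in one step if for some rule $t\to v$ in $\Pi_S$ the coefficient $c_t$ of the monomial $t$ in $f$ is non-zero and $g=f-c_tt+c_tv$; let $\to^*$ be the reflexive-transitive closure. $\Pi_S$ is terminating if there is no infinite chain of one-step rewritings, confluent if whenever $f\to^*g$ and $f\to^*h$ there is $e$ with $g\to^*e$ and $h\to^*e$, and convergent if it is terminating and confluent. An element of $k\mathfrak M(X)$ is trivial modulo $(S,w)$ if it is a $k$-linear combination of elements $q|_s$ with $s\in S$, $q\in\mathfrak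 M^\star(X)$ and $q|_{\bar s}<w$. $S$ is a Gröbner–Shirshov basis if for all $f,g\in S$ (including $f=g$): (i) $f\mu-\nu g$ is trivial modulo $(S,w)$ whenever $w,\mu,\nu\in\mathfrak M(X)$ satisfy $w=\bar f\mu=\nu\bar g$ and $\max(|\bar f|,|\bar g|)<|w|<|\bar f|+|\bar g|$; and (ii) $f-q|_g$ is trivial modulo $(S,w)$ whenever $q\in\mathfrak M^\star(X)$ and $w=\bar f=q|_{\bar g}$. Then the following are equivalent: 1. $\Pi_S$ is convergent; 2. $\Pi_S$ is confluent; 3. $\mathrm{Id}(S)\cap k\,\mathrm{Irr}(S)=0$; 4. $k\mathfrak M(X)=\mathrm{Id}(S)\oplus k\,\mathrm{Irr}(S)$; 5. $S$ is a Gröbner–Shirshov basis in $k\mathfrak M(X)$. -/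

import Mathlib

universe u v w

/-- The bracketed words on `X`, i.e. the underlying set of the free operated monoid `𝔐(X)`.
A word is either the empty word `1`, or a letter `x ∈ X` followed by a word, or a bracket `⌊a⌋`
(with `a` a word) followed by a word.  Equivalently, it is a finite sequence of elements of
`X ⊔ ⌊𝔐(X)⌋`, which is the union of the finite stages `𝔐ₙ(X) = M(X ⊔ ⌊𝔐ₙ₋₁(X)⌋)`. -/
inductive BracketedWord (X : Type u) : Type u
  | nil : BracketedWord X
  | var (x : X) (r : BracketedWord X) : BracketedWord X
  | br (a r : BracketedWord X) : BracketedWord X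

namespace BracketedWord

variable {X : Type u}

/-- Concatenation of bracketed words. -/
def append : BracketedWord X → BracketedWord X → BracketedWord X
  | nil, b => b
  | var x r, b => var x (append r b)
  | br a r, b => br a (append r b)

instance : One (BracketedWord X) := ⟨nil⟩

instance : Mul (BracketedWord X) := ⟨append⟩

theorem append_nil (a : BracketedWord X) : append a nil = a := by
  induction a with
  | nil => rfl
  | var x r ih => simp only [append, ih]
  | br a r _ ih => simp only [append, ih]

theorem append_assoc (a b c : BracketedWord X) :
    append (append a b) c = append a (append b c) := by
  induction a with
  | nil => rfl
  | var x r ih => simp only [append, ih]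
  | br a r _ ih => simp only [append, ih]

/-- `𝔐(X)` is a monoid under concatenation. -/
instance : Monoid (BracketedWord X) where
  mul_assoc := append_assoc
  one_mul _ := rfl
  mul_one := append_nil

/-- The operator `a ↦ ⌊a⌋` of the operated monoid `𝔐(X)`. -/
def bracket (a : BracketedWord X) : BracketedWord X := br a 1

/-- The breadth `|a|`: the number of factors of `a` in `X ⊔ ⌊𝔐(X)⌋`. -/
def breadth : BracketedWord X → ℕ
  | nil => 0
  | var _ r => breadth r + 1
  | br _ r => breadth r + 1

/-- The number of occurrences (at any depth) of the extra letter `⋆ = none` in a bracketed word on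
`X ⊔ {⋆} = Option X`. -/
def starCount : BracketedWord (Option X) → ℕ
  | nil => 0
  | var none r => starCount r + 1
  | var (some _) r => starCount r
  | br a r => starCount a + starCount r

/-- Replace each occurrence of `⋆ = none` by the bracketed word `b`. -/
def substStar (b : BracketedWord X) : BracketedWord (Option X) → BracketedWord X
  | nil => 1
  | var none r => b * substStar b r
  | var (some x) r => var x (substStar b r)
  | br a r => br (substStar b a) (substStar b r)

end BracketedWord

/-- The `⋆`-bracketed words on `X`: the bracketed words on `X ⊔ {⋆}` with exactly one occurrence
of `⋆`. -/
def StarWord (X : Type u) : Type u :=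
  {q : BracketedWord (Option X) // BracketedWord.starCount q = 1}

/-- `q|_b`, for `q` a `⋆`-bracketed word and `b` a bracketed word. -/
def StarWord.plug {X : Type u} (q : StarWord X) (b : BracketedWord X) : BracketedWord X :=
  BracketedWord.substStar b q.1

/-- The algebra `k𝔐(X)` of bracketed polynomials. -/
abbrev BracketedPoly (k : Type v) (X : Type u) [CommRing k] : Type (max u v) :=
  MonoidAlgebra k (BracketedWord X)

/-- The given linear order on `𝔐(X)` is a monomial order. -/
structure IsMonomialOrder (X : Type u) [LinearOrder (BracketedWord X)] : Prop where
  wellFounded : WellFounded fun a b : BracketedWord X => a < b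
  plug_lt_plug : ∀ (a b : BracketedWord X) (q : StarWord X), a < b → q.plug a < q.plug b

/-! ### Term-rewriting systems on a free module `V` with basis `b` indexed by `W` -/

namespace TermRewriting

variable {k : Type u} {W : Type v} {V : Type w} [CommRing k] [AddCommGroup V] [Module k V]

/-- `R_t(f) = c_t t - f`, with `c_t` the coefficient of `t` in `f`. -/
noncomputable def rest (b : Module.Basis W k V) (t : W) (f : V) : V :=
  b.repr f t • b t - f

/-- One-step rewriting for the term-rewriting system `P ⊆ W × V`: for some rule `t → v` in `P` with
`t ∈ Supp(f)`, i.e. with `c_t ≠ 0`, the element `f = c_t t - R_t(f)` is replaced by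
`c_t v - R_t(f)`. -/
def OneStep (b : Module.Basis W k V) (P : Set (W × V)) (f g : V) : Prop :=
  ∃ t v, (t, v) ∈ P ∧ b.repr f t ≠ 0 ∧ g = b.repr f t • v - rest b t f

/-- The reflexive-transitive closure of one-step rewriting. -/
def Rewrites (b : Module.Basis W k V) (P : Set (W × V)) (f g : V) : Prop :=
  Relation.ReflTransGen (OneStep b P) f g

def Joinable (b : Module.Basis W k V) (P : Set (W × V)) (f g : V) : Prop :=
  ∃ h, Rewrites b P f h ∧ Rewrites b P g h

/-- There is no infinite chain of one-step rewritings. -/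
def Terminating (b : Module.Basis W k V) (P : Set (W × V)) : Prop :=
  ¬ ∃ f : ℕ → V, ∀ n, OneStep b P (f n) (f (n + 1))

def Confluent (b : Module.Basis W k V) (P : Set (W × V)) : Prop :=
  ∀ f g h, Rewrites b P f g → Rewrites b P f h → Joinable b P g h

def Convergent (b : Module.Basis W k V) (P : Set (W × V)) : Prop :=
  Terminating b P ∧ Confluent b P

end TermRewriting

namespace BracketedPoly

variable {k : Type v} {X : Type u} [CommRing k]

/-- The bracketed word `a` as an element of `k𝔐(X)`. -/
noncomputable def mono (k : Type v) {X : Type u} [CommRing k] (a : BracketedWord X) :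
    BracketedPoly k X :=
  MonoidAlgebra.single a 1

/-- The linear extension of `a ↦ ⌊a⌋` to `k𝔐(X)`. -/
noncomputable def bracket (f : BracketedPoly k X) : BracketedPoly k X :=
  MonoidAlgebra.mapDomain BracketedWord.bracket f

/-- `q|_f = ∑ cᵢ q|_{aᵢ}` for `f = ∑ cᵢ aᵢ`. -/
noncomputable def plug (q : StarWord X) (f : BracketedPoly k X) : BracketedPoly k X :=
  MonoidAlgebra.mapDomain q.plug f

/-- A `k`-submodule of `k𝔐(X)` is an operated ideal if it is a two-sided ideal that is closed under
the operator `⌊ ⌋`. -/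
structure IsOperatedIdeal (I : Submodule k (BracketedPoly k X)) : Prop where
  mul_mem_left : ∀ a f : BracketedPoly k X, f ∈ I → a * f ∈ I
  mul_mem_right : ∀ a f : BracketedPoly k X, f ∈ I → f * a ∈ I
  bracket_mem : ∀ f : BracketedPoly k X, f ∈ I → bracket f ∈ I

/-- `Id(S)`: the smallest operated ideal of `k𝔐(X)` that contains `S`. -/
noncomputable def operatedIdeal (S : Set (BracketedPoly k X)) : Submodule k (BracketedPoly k X) :=
  sInf {I | IsOperatedIdeal I ∧ S ⊆ (I : Set (BracketedPoly k X))}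

theorem isLeast_operatedIdeal (S : Set (BracketedPoly k X)) :
    IsLeast {I | IsOperatedIdeal I ∧ S ⊆ (I : Set (BracketedPoly k X))} (operatedIdeal S) := by
  refine ⟨⟨⟨?_, ?_, ?_⟩, ?_⟩, fun I hI => sInf_le hI⟩
  · intro a f hf
    rw [operatedIdeal, Submodule.mem_sInf] at hf ⊢
    exact fun I hI => hI.1.mul_mem_left a f (hf I hI)
  · intro a f hf
    rw [operatedIdeal, Submodule.mem_sInf] at hf ⊢
    exact fun I hI => hI.1.mul_mem_right a f (hf I hI)
  · intro f hf
    rw [operatedIdeal, Submodule.mem_sInf] at hf ⊢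
    exact fun I hI => hI.1.bracket_mem f (hf I hI)
  · intro s hs
    rw [SetLike.mem_coe, operatedIdeal, Submodule.mem_sInf]
    exact fun I hI => hI.2 hs

variable [LinearOrder (BracketedWord X)]

open Classical in
/-- The leading monomial: the largest monomial that appears in `s`.  It is `1` for `s = 0`, hence
for every `s ∈ k`. -/
noncomputable def leadingMonomial (s : BracketedPoly k X) : BracketedWord X :=
  if h : s.coeff.support.Nonempty then s.coeff.support.max' h else 1

/-- The coefficient of the leading monomial. -/
noncomputable def leadingCoeff (s : BracketedPoly k X) : k :=
  s.coeff (leadingMonomial s)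

/-- `s` is monic: it is not a constant and its leading coefficient is `1`. -/
def IsMonic (s : BracketedPoly k X) : Prop :=
  s ∉ Set.range (algebraMap k (BracketedPoly k X)) ∧ leadingCoeff s = 1

/-- `R(s) = c_s s̄ - s`. -/
noncomputable def remainder (s : BracketedPoly k X) : BracketedPoly k X :=
  leadingCoeff s • mono k (leadingMonomial s) - s

/-- The term-rewriting system `Π_S` of all rules `q|_{s̄} → q|_{R(s)}` with `s ∈ S` and `q` a
`⋆`-bracketed word. -/
def rewritingSystem (S : Set (BracketedPoly k X)) :
    Set (BracketedWord X × BracketedPoly k X) :=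
  {p | ∃ s ∈ S, ∃ q : StarWord X, p = (q.plug (leadingMonomial s), plug q (remainder s))}

/-- `Irr(S) = 𝔐(X) \ {q|_{s̄} | s ∈ S, q a ⋆-bracketed word}`. -/
def irr (S : Set (BracketedPoly k X)) : Set (BracketedWord X) :=
  {a | ∃ s ∈ S, ∃ q : StarWord X, q.plug (leadingMonomial s) = a}ᶜ

/-- `k Irr(S)`: the `k`-span of `Irr(S)`. -/
noncomputable def irrSpan (S : Set (BracketedPoly k X)) : Submodule k (BracketedPoly k X) :=
  Submodule.span k (mono k '' irr S)

/-- `f` is trivial modulo `(S, a)`: it is a `k`-linear combination of elements `q|_s` with `s ∈ S`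
and `q|_{s̄} < a`. -/
def IsTrivialMod (S : Set (BracketedPoly k X)) (a : BracketedWord X) (f : BracketedPoly k X) :
    Prop :=
  f ∈ Submodule.span k
    {g | ∃ s ∈ S, ∃ q : StarWord X, q.plug (leadingMonomial s) < a ∧ g = plug q s}

/-- `S` is a Gröbner–Shirshov basis: all intersection compositions `f μ - ν g` (where
`a = f̄ μ = ν ḡ` and `max(|f̄|, |ḡ|) < |a| < |f̄| + |ḡ|`) and all including compositions `f - q|_g`
(where `a = f̄ = q|_{ḡ}`) of elements `f, g ∈ S` are trivial modulo `(S, a)`. -/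
structure IsGroebnerShirshov (S : Set (BracketedPoly k X)) : Prop where
  intersection : ∀ f ∈ S, ∀ g ∈ S, ∀ a m n : BracketedWord X,
    a = leadingMonomial f * m → a = n * leadingMonomial g →
    max (leadingMonomial f).breadth (leadingMonomial g).breadth < a.breadth →
    a.breadth < (leadingMonomial f).breadth + (leadingMonomial g).breadth →
    IsTrivialMod S a (f * mono k m - mono k n * g)
  including : ∀ f ∈ S, ∀ g ∈ S, ∀ (a : BracketedWord X) (q : StarWord X),
    a = leadingMonomial f → a = q.plug (leadingMonomial g) →
    IsTrivialMod S a (f - plug q g)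

end BracketedPoly

/-! The hub is condition 3, `operatedIdeal S ⊓ irrSpan S = ⊥`. Three facts hold for every monic `S`.
Each rewriting step subtracts a multiple of some `q|_s`, and `Id(S)` is exactly the span of these
elements. Rewriting terminates, because a step clears one coefficient and disturbs only smaller
monomials. Hence every `f` has a normal form in `k Irr(S)` congruent to it modulo `Id(S)`, so `Id(S)
+ k Irr(S)` is everything, and 3 and 4 agree.

Under 3 the normal form is unique, which is confluence. Conversely, adding a multiple of `q|_s` to
an element leaves it joinable with the original; under confluence joinability is transitive, so
every element of `Id(S)` is joinable with `0`, and an irreducible one must equal `0`.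

Under 3 an element of `Id(S)` also rewrites to `0`, and the steps used exhibit it as a combination
of elements `q|_s` led by its own monomials or smaller ones. Applied to compositions, whose leading
terms cancel, this gives 5.

The hard direction is 5 to 3 (Composition-Diamond). Two occurrences of leading monomials in one word
are disjoint, nested or overlapping, so `φ(f) - ψ(g)` with equal leading words is trivial
(`IsGroebnerShirshov.isTrivialMod_sub`). An irreducible element of `Id(S)` can then be expressed
with ever smaller leading words, and well-foundedness forces it to be `0`. -/

namespace BracketedWord

variable {X : Type u}

/-! ### Concatenation and breadth -/

@[simp] theorem nil_mul (a : BracketedWord X) : (nil : BracketedWord X) * a = a := rfl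

@[simp] theorem var_mul (x : X) (r b : BracketedWord X) : var x r * b = var x (r * b) := rfl

@[simp] theorem br_mul (a r b : BracketedWord X) : br a r * b = br a (r * b) := rfl

theorem breadth_mul (a b : BracketedWord X) : (a * b).breadth = a.breadth + b.breadth := by
  induction a with
  | nil => simp [breadth]
  | var x r ih => simp only [var_mul, breadth, ih]; omega
  | br a r _ ih => simp only [br_mul, breadth, ih]; omega

theorem breadth_pos {a : BracketedWord X} (h : a ≠ 1) : 0 < a.breadth := by
  cases a with
  | nil => exact absurd rfl h
  | var x r => simp [breadth]
  | br a r => simp [breadth]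

/-- Levi's lemma for concatenation of bracketed words. -/
theorem mul_eq_mul_cases {a b u v : BracketedWord X} (h : a * b = u * v) :
    (∃ c, u = a * c ∧ b = c * v) ∨ ∃ c, a = u * c ∧ v = c * b := by
  induction a generalizing u with
  | nil => exact Or.inl ⟨u, rfl, h⟩
  | var x r ih =>
    cases u with
    | nil => exact Or.inr ⟨var x r, rfl, h.symm⟩
    | var y u' =>
      simp only [var_mul, var.injEq] at h
      obtain ⟨rfl, h⟩ := h
      rcases ih h with ⟨c, rfl, rfl⟩ | ⟨c, rfl, rfl⟩
      · exact Or.inl ⟨c, rfl, rfl⟩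
      · exact Or.inr ⟨c, rfl, rfl⟩
    | br y u' => simp at h
  | br a r _ ih =>
    cases u with
    | nil => exact Or.inr ⟨br a r, rfl, h.symm⟩
    | var y u' => simp at h
    | br y u' =>
      simp only [br_mul, br.injEq] at h
      obtain ⟨rfl, h⟩ := h
      rcases ih h with ⟨c, rfl, rfl⟩ | ⟨c, rfl, rfl⟩
      · exact Or.inl ⟨c, rfl, rfl⟩
      · exact Or.inr ⟨c, rfl, rfl⟩

/-! ### Contexts and the position of the star -/

/-- The maps `b ↦ q|_b` for a `⋆`-bracketed word `q`, described by the position of `⋆`. -/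
inductive IsContext : (BracketedWord X → BracketedWord X) → Prop
  | head (r : BracketedWord X) : IsContext fun b => b * r
  | var (x : X) {φ : BracketedWord X → BracketedWord X} (h : IsContext φ) :
      IsContext fun b => var x (φ b)
  | brInner (r : BracketedWord X) {φ : BracketedWord X → BracketedWord X} (h : IsContext φ) :
      IsContext fun b => br (φ b) r
  | brOuter (a : BracketedWord X) {φ : BracketedWord X → BracketedWord X} (h : IsContext φ) :
      IsContext fun b => br a (φ b)

theorem isContext_id : IsContext fun b : BracketedWord X => b := by
  simpa using IsContext.head (1 : BracketedWord X)

theorem IsContext.mul_right {φ : BracketedWord X → BracketedWord X} (h : IsContext φ)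
    (r : BracketedWord X) : IsContext fun b => φ b * r := by
  induction h with
  | head r' => simpa only [mul_assoc] using IsContext.head (r' * r)
  | var x _ ih => exact .var x ih
  | brInner r' h _ => exact .brInner (r' * r) h
  | brOuter a _ ih => exact .brOuter a ih

theorem IsContext.mul_left {φ : BracketedWord X → BracketedWord X} (h : IsContext φ)
    (a : BracketedWord X) : IsContext fun b => a * φ b := by
  induction a with
  | nil => exact h
  | var x _ ih => exact .var x ih
  | br a _ _ ih => exact .brOuter a ih

theorem IsContext.comp {φ ψ : BracketedWord X → BracketedWord X} (hφ : IsContext φ)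
    (hψ : IsContext ψ) : IsContext fun b => φ (ψ b) := by
  induction hφ with
  | head r => exact hψ.mul_right r
  | var x _ ih => exact .var x ih
  | brInner r _ ih => exact .brInner r ih
  | brOuter a _ ih => exact .brOuter a ih

theorem exists_substStar_eq_of_starCount_eq_zero {p : BracketedWord (Option X)}
    (h : p.starCount = 0) : ∃ r : BracketedWord X, ∀ b, substStar b p = r := by
  induction p with
  | nil => exact ⟨1, fun _ => rfl⟩
  | var x r ih =>
    cases x with
    | none => simp [starCount] at h
    | some x =>
      obtain ⟨r', hr⟩ := ih h
      exact ⟨var x r', fun b => by rw [substStar, hr]⟩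
  | br a r iha ihr =>
    simp only [starCount, Nat.add_eq_zero_iff] at h
    obtain ⟨a', ha⟩ := iha h.1
    obtain ⟨r', hr⟩ := ihr h.2
    exact ⟨br a' r', fun b => by rw [substStar, hr, ha]⟩

theorem isContext_substStar {p : BracketedWord (Option X)} (h : p.starCount = 1) :
    IsContext fun b => substStar b p := by
  induction p with
  | nil => simp [starCount] at h
  | var x r ih =>
    cases x with
    | none =>
      obtain ⟨r', hr⟩ := exists_substStar_eq_of_starCount_eq_zero (p := r)
        (by simpa [starCount] using h)
      simpa only [substStar, hr] using IsContext.head r'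
    | some x => exact .var x (ih h)
  | br a r iha ihr =>
    simp only [starCount, Nat.add_eq_one_iff] at h
    rcases h with ⟨ha, hr⟩ | ⟨ha, hr⟩
    · obtain ⟨a', ha⟩ := exists_substStar_eq_of_starCount_eq_zero ha
      simpa only [substStar, ha] using IsContext.brOuter a' (ihr hr)
    · obtain ⟨r', hr⟩ := exists_substStar_eq_of_starCount_eq_zero hr
      simpa only [substStar, hr] using IsContext.brInner r' (iha ha)

theorem isContext_plug (q : StarWord X) : IsContext q.plug := isContext_substStar q.2

theorem exists_starCount_eq_zero (r : BracketedWord X) :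
    ∃ p : BracketedWord (Option X), p.starCount = 0 ∧ ∀ b, substStar b p = r := by
  induction r with
  | nil => exact ⟨nil, rfl, fun _ => rfl⟩
  | var x r ih =>
    obtain ⟨p, hp, h⟩ := ih
    exact ⟨var (some x) p, hp, fun b => by rw [substStar, h]⟩
  | br a r iha ihr =>
    obtain ⟨p, hp, h⟩ := iha
    obtain ⟨p', hp', h'⟩ := ihr
    exact ⟨br p p', by simp [starCount, hp, hp'], fun b => by rw [substStar, h, h']⟩

/-- Converse of `isContext_plug`: contexts and star words give the same maps, so arguments about `q`
become inductions on the path to the star. -/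
theorem IsContext.exists_plug {φ : BracketedWord X → BracketedWord X} (h : IsContext φ) :
    ∃ q : StarWord X, q.plug = φ := by
  induction h with
  | head r =>
    obtain ⟨p, hp, h⟩ := exists_starCount_eq_zero r
    exact ⟨⟨.var none p, by simp [starCount, hp]⟩, funext fun b => by
      simp [StarWord.plug, substStar, h]⟩
  | var x _ ih =>
    obtain ⟨q, rfl⟩ := ih
    exact ⟨⟨.var (some x) q.1, q.2⟩, rfl⟩
  | brInner r _ ih =>
    obtain ⟨q, rfl⟩ := ih
    obtain ⟨p, hp, h⟩ := exists_starCount_eq_zero r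
    exact ⟨⟨.br q.1 p, by simp [starCount, hp, q.2]⟩, funext fun b => by
      simp [StarWord.plug, substStar, h]⟩
  | brOuter a _ ih =>
    obtain ⟨q, rfl⟩ := ih
    obtain ⟨p, hp, h⟩ := exists_starCount_eq_zero a
    exact ⟨⟨.br p q.1, by simp [starCount, hp, q.2]⟩, funext fun b => by
      simp [StarWord.plug, substStar, h]⟩

/-- If `φ b = u * v` for a context `φ`, then the distinguished occurrence of `b` lies in `u`, or
lies in `v`, or straddles both at top level. -/
theorem IsContext.eq_mul_cases {φ : BracketedWord X → BracketedWord X} (hφ : IsContext φ)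
    {b u v : BracketedWord X} (h : φ b = u * v) :
    (∃ p, IsContext p ∧ u = p b ∧ φ = fun c => p c * v) ∨
    (∃ p, IsContext p ∧ v = p b ∧ φ = fun c => u * p c) ∨
    ∃ n m b₁ b₂, b = b₁ * b₂ ∧ u = n * b₁ ∧ v = b₂ * m ∧ φ = fun c => n * (c * m) := by
  induction hφ generalizing u with
  | head r =>
    rcases mul_eq_mul_cases h with ⟨c, rfl, rfl⟩ | ⟨c, rfl, rfl⟩
    · exact Or.inl ⟨_, .head c, rfl, by simp only [mul_assoc]⟩
    · exact Or.inr (Or.inr ⟨1, r, u, c, rfl, rfl, rfl, rfl⟩)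
  | @var x φ hφ ih =>
    cases u with
    | nil => exact Or.inr (Or.inl ⟨_, .var x hφ, h.symm, rfl⟩)
    | var y u =>
      simp only [var_mul, var.injEq] at h
      obtain ⟨rfl, h⟩ := h
      rcases ih h with ⟨p, hp, rfl, rfl⟩ | ⟨p, hp, rfl, rfl⟩ | ⟨n, m, b₁, b₂, rfl, rfl, rfl, rfl⟩
      · exact Or.inl ⟨_, .var x hp, rfl, rfl⟩
      · exact Or.inr (Or.inl ⟨p, hp, rfl, rfl⟩)
      · exact Or.inr (Or.inr ⟨.var x n, m, b₁, b₂, rfl, rfl, rfl, rfl⟩)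
    | br a u => simp at h
  -- A bracket is a single top-level factor, so the cut between `u` and `v` cannot pass inside it
  -- and no induction hypothesis is needed.
  | @brInner r φ hφ _ =>
    cases u with
    | nil => exact Or.inr (Or.inl ⟨_, .brInner r hφ, h.symm, rfl⟩)
    | var y u => simp at h
    | br a u =>
      simp only [br_mul, br.injEq] at h
      obtain ⟨rfl, rfl⟩ := h
      exact Or.inl ⟨_, .brInner u hφ, rfl, rfl⟩
  | @brOuter a φ hφ ih =>
    cases u with
    | nil => exact Or.inr (Or.inl ⟨_, .brOuter a hφ, h.symm, rfl⟩)
    | var y u => simp at h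
    | br a' u =>
      simp only [br_mul, br.injEq] at h
      obtain ⟨rfl, h⟩ := h
      rcases ih h with ⟨p, hp, rfl, rfl⟩ | ⟨p, hp, rfl, rfl⟩ | ⟨n, m, b₁, b₂, rfl, rfl, rfl, rfl⟩
      · exact Or.inl ⟨_, .brOuter a hp, rfl, rfl⟩
      · exact Or.inr (Or.inl ⟨p, hp, rfl, rfl⟩)
      · exact Or.inr (Or.inr ⟨.br a n, m, b₁, b₂, rfl, rfl, rfl, rfl⟩)

end BracketedWord

/-! ### Linear extensions and the operated ideal as a span -/

namespace BracketedPoly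

open BracketedWord

variable {k : Type v} {X : Type u} [CommRing k]

/-- The linear extension to `k𝔐(X)` of a map `φ` on bracketed words. -/
noncomputable def linearExtend (k : Type v) {X : Type u} [CommRing k]
    (φ : BracketedWord X → BracketedWord X) : BracketedPoly k X →ₗ[k] BracketedPoly k X :=
  MonoidAlgebra.mapDomainLinearMap k k φ

theorem plug_eq (q : StarWord X) (f : BracketedPoly k X) : plug q f = linearExtend k q.plug f :=
  rfl

theorem bracket_eq (f : BracketedPoly k X) :
    bracket f = linearExtend k BracketedWord.bracket f := rfl

@[simp] theorem linearExtend_mono (φ : BracketedWord X → BracketedWord X) (a : BracketedWord X) :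
    linearExtend k φ (mono k a) = mono k (φ a) :=
  MonoidAlgebra.mapDomainLinearMap_single φ 1 a

theorem linearExtend_linearExtend (φ ψ : BracketedWord X → BracketedWord X)
    (f : BracketedPoly k X) :
    linearExtend k φ (linearExtend k ψ f) = linearExtend k (fun b => φ (ψ b)) f :=
  (LinearMap.congr_fun (MonoidAlgebra.mapDomainLinearMap_comp (R := k) (S := k) ψ φ) f).symm

theorem linearExtend_id (f : BracketedPoly k X) : linearExtend k (fun b => b) f = f := by
  rw [linearExtend, ← MonoidAlgebra.coeff_inj, MonoidAlgebra.coeff_mapDomainLinearMap]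
  exact Finsupp.mapDomain_id

theorem coeff_mono (a b : BracketedWord X) [Decidable (a = b)] :
    (mono k a).coeff b = if a = b then 1 else 0 :=
  Finsupp.single_apply

theorem mem_span_mono_iff {A : Set (BracketedWord X)} {f : BracketedPoly k X} :
    f ∈ Submodule.span k (mono k '' A) ↔ ∀ a, f.coeff a ≠ 0 → a ∈ A := by
  classical
  refine ⟨fun hf => ?_, fun hf => ?_⟩
  · induction hf using Submodule.span_induction with
    | mem g hg =>
      obtain ⟨b, hb, rfl⟩ := hg
      intro a ha
      rw [coeff_mono] at ha
      obtain rfl : b = a := by by_contra h; simp [h] at ha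
      exact hb
    | zero => intro a ha; simp at ha
    | add f g _ _ ihf ihg =>
      intro a ha
      by_cases h : f.coeff a = 0
      · exact ihg a fun h' => ha (by simp [h, h'])
      · exact ihf a h
    | smul c f _ ih => exact fun a ha => ih a fun h => ha (by simp [h])
  · rw [← MonoidAlgebra.sum_coeff_single f]
    refine Submodule.sum_mem _ fun a ha => ?_
    have : MonoidAlgebra.single a (f.coeff a) = f.coeff a • mono k a := by
      simp [mono]
    rw [this]
    exact Submodule.smul_mem _ _ (Submodule.subset_span ⟨a, hf a (by simpa using ha), rfl⟩)

@[elab_as_elim]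
theorem mono_induction {p : BracketedPoly k X → Prop} (f : BracketedPoly k X)
    (zero : p 0) (add : ∀ f g, p f → p g → p (f + g))
    (smul_mono : ∀ (c : k) a, p (c • mono k a)) : p f :=
  MonoidAlgebra.induction_linear f zero add fun a c => by simpa [mono] using smul_mono c a

theorem linearExtend_mul_mono (φ : BracketedWord X → BracketedWord X) (f : BracketedPoly k X)
    (a : BracketedWord X) :
    linearExtend k φ f * mono k a = linearExtend k (fun b => φ b * a) f := by
  induction f using mono_induction with
  | zero => simp
  | add f g hf hg => rw [map_add, map_add, add_mul, hf, hg]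
  | smul_mono c b =>
    rw [map_smul, map_smul, smul_mul_assoc, linearExtend_mono, linearExtend_mono]
    simp [mono]

theorem mono_mul_linearExtend (φ : BracketedWord X → BracketedWord X) (f : BracketedPoly k X)
    (a : BracketedWord X) :
    mono k a * linearExtend k φ f = linearExtend k (fun b => a * φ b) f := by
  induction f using mono_induction with
  | zero => simp
  | add f g hf hg => rw [map_add, map_add, mul_add, hf, hg]
  | smul_mono c b =>
    rw [map_smul, map_smul, mul_smul_comm, linearExtend_mono, linearExtend_mono]
    simp [mono]

/-- Operated ideals are closed under `f ↦ q|_f`. -/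
theorem linearExtend_mem_of_isOperatedIdeal {I : Submodule k (BracketedPoly k X)}
    (hI : IsOperatedIdeal I) {φ : BracketedWord X → BracketedWord X} (hφ : IsContext φ)
    {f : BracketedPoly k X} (hf : f ∈ I) : linearExtend k φ f ∈ I := by
  induction hφ with
  | head r =>
    rw [← linearExtend_mul_mono (fun b => b), linearExtend_id]
    exact hI.mul_mem_right _ _ hf
  | @var x φ _ ih =>
    have := hI.mul_mem_left (mono k (.var x 1)) _ ih
    rwa [mono_mul_linearExtend] at this
  | @brInner r φ _ ih =>
    have := hI.mul_mem_right (mono k r) _ (hI.bracket_mem _ ih)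
    rwa [bracket_eq, linearExtend_linearExtend, linearExtend_mul_mono] at this
  | @brOuter a φ _ ih =>
    have := hI.mul_mem_left (mono k (.br a 1)) _ ih
    rwa [mono_mul_linearExtend] at this

/-- `Id(S)` is spanned by the elements `q|_s`. -/
theorem operatedIdeal_eq_span (S : Set (BracketedPoly k X)) :
    operatedIdeal S = Submodule.span k {g | ∃ s ∈ S, ∃ φ, IsContext φ ∧ g = linearExtend k φ s} := by
  -- The span is itself an operated ideal: multiplying by a word on either side, or bracketing,
  -- turns a context into a context.
  refine le_antisymm ((isLeast_operatedIdeal S).2 ⟨⟨?_, ?_, ?_⟩, ?_⟩) (Submodule.span_le.2 ?_)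
  · intro a f hf
    induction hf using Submodule.span_induction with
    | mem g hg =>
      obtain ⟨s, hs, φ, hφ, rfl⟩ := hg
      induction a using mono_induction with
      | zero => simp
      | add f g hf hg => rw [add_mul]; exact add_mem hf hg
      | smul_mono c b =>
        rw [smul_mul_assoc, mono_mul_linearExtend]
        exact Submodule.smul_mem _ _ (Submodule.subset_span ⟨s, hs, _, hφ.mul_left b, rfl⟩)
    | zero => simp
    | add f g _ _ ihf ihg => rw [mul_add]; exact add_mem ihf ihg
    | smul c f _ ih => rw [mul_smul_comm]; exact Submodule.smul_mem _ _ ih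
  · intro a f hf
    induction hf using Submodule.span_induction with
    | mem g hg =>
      obtain ⟨s, hs, φ, hφ, rfl⟩ := hg
      induction a using mono_induction with
      | zero => simp
      | add f g hf hg => rw [mul_add]; exact add_mem hf hg
      | smul_mono c b =>
        rw [mul_smul_comm, linearExtend_mul_mono]
        exact Submodule.smul_mem _ _ (Submodule.subset_span ⟨s, hs, _, hφ.mul_right b, rfl⟩)
    | zero => simp
    | add f g _ _ ihf ihg => rw [add_mul]; exact add_mem ihf ihg
    | smul c f _ ih => rw [smul_mul_assoc]; exact Submodule.smul_mem _ _ ih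
  · intro f hf
    rw [bracket_eq]
    induction hf using Submodule.span_induction with
    | mem g hg =>
      obtain ⟨s, hs, φ, hφ, rfl⟩ := hg
      rw [linearExtend_linearExtend]
      exact Submodule.subset_span ⟨s, hs, _, .brInner 1 hφ, rfl⟩
    | zero => simp
    | add f g _ _ ihf ihg => rw [map_add]; exact add_mem ihf ihg
    | smul c f _ ih => rw [map_smul]; exact Submodule.smul_mem _ _ ih
  · exact fun s hs => Submodule.subset_span ⟨s, hs, _, isContext_id, (linearExtend_id s).symm⟩
  · rintro _ ⟨s, hs, φ, hφ, rfl⟩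
    have h := (isLeast_operatedIdeal S).1
    exact linearExtend_mem_of_isOperatedIdeal h.1 hφ (h.2 hs)

/-! ### Leading monomials under contexts -/

variable [LinearOrder (BracketedWord X)]

theorem _root_.IsMonomialOrder.strictMono (hle : IsMonomialOrder X)
    {φ : BracketedWord X → BracketedWord X} (hφ : IsContext φ) : StrictMono φ := by
  obtain ⟨q, rfl⟩ := hφ.exists_plug
  exact fun a b h => hle.plug_lt_plug a b q h

/-- The span of the bracketed words below `a`. -/
noncomputable def lowerSpan (k : Type v) {X : Type u} [CommRing k] [LinearOrder (BracketedWord X)]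
    (a : BracketedWord X) : Submodule k (BracketedPoly k X) :=
  Submodule.span k (mono k '' Set.Iio a)

theorem mem_lowerSpan {a : BracketedWord X} {f : BracketedPoly k X} :
    f ∈ lowerSpan k a ↔ ∀ b, f.coeff b ≠ 0 → b < a := mem_span_mono_iff

theorem linearExtend_mem_lowerSpan {φ : BracketedWord X → BracketedWord X} (hφ : StrictMono φ)
    {a : BracketedWord X} {f : BracketedPoly k X} (hf : f ∈ lowerSpan k a) :
    linearExtend k φ f ∈ lowerSpan k (φ a) := by
  induction hf using Submodule.span_induction with
  | mem g hg =>
    obtain ⟨b, hb, rfl⟩ := hg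
    rw [linearExtend_mono]
    exact Submodule.subset_span ⟨_, hφ hb, rfl⟩
  | zero => simp
  | add f g _ _ ihf ihg => rw [map_add]; exact add_mem ihf ihg
  | smul c f _ ih => rw [map_smul]; exact Submodule.smul_mem _ _ ih

theorem le_leadingMonomial {f : BracketedPoly k X} {a : BracketedWord X} (h : f.coeff a ≠ 0) :
    a ≤ leadingMonomial f := by
  have hne : f.coeff.support.Nonempty := ⟨a, by simpa using h⟩
  rw [leadingMonomial, dif_pos hne]
  exact Finset.le_max' _ _ (by simpa using h)

theorem IsMonic.sub_mem_lowerSpan {s : BracketedPoly k X} (hs : IsMonic s) :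
    s - mono k (leadingMonomial s) ∈ lowerSpan k (leadingMonomial s) := by
  classical
  refine mem_lowerSpan.2 fun b hb => ?_
  rw [MonoidAlgebra.coeff_sub, Finsupp.sub_apply, coeff_mono] at hb
  by_cases h : leadingMonomial s = b
  · rw [if_pos h, ← h] at hb
    exact absurd (sub_eq_zero.2 hs.2) hb
  · rw [if_neg h, sub_zero] at hb
    exact lt_of_le_of_ne (le_leadingMonomial hb) (Ne.symm h)

theorem IsMonic.linearExtend_sub_mem (hle : IsMonomialOrder X) {s : BracketedPoly k X}
    (hs : IsMonic s) {φ : BracketedWord X → BracketedWord X} (hφ : IsContext φ) :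
    linearExtend k φ s - mono k (φ (leadingMonomial s)) ∈ lowerSpan k (φ (leadingMonomial s)) := by
  have := linearExtend_mem_lowerSpan (hle.strictMono hφ) hs.sub_mem_lowerSpan
  rwa [map_sub, linearExtend_mono] at this

theorem IsMonic.coeff_linearExtend_self (hle : IsMonomialOrder X) {s : BracketedPoly k X}
    (hs : IsMonic s) {φ : BracketedWord X → BracketedWord X} (hφ : IsContext φ) :
    (linearExtend k φ s).coeff (φ (leadingMonomial s)) = 1 := by
  classical
  by_contra h
  refine lt_irrefl _ (mem_lowerSpan.1 (hs.linearExtend_sub_mem hle hφ) (φ (leadingMonomial s)) ?_)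
  simpa [coeff_mono, sub_eq_zero] using h

theorem IsMonic.le_of_coeff_linearExtend_ne_zero (hle : IsMonomialOrder X) {s : BracketedPoly k X}
    (hs : IsMonic s) {φ : BracketedWord X → BracketedWord X} (hφ : IsContext φ)
    {b : BracketedWord X} (hb : (linearExtend k φ s).coeff b ≠ 0) :
    b ≤ φ (leadingMonomial s) := by
  classical
  by_contra h
  refine h (mem_lowerSpan.1 (hs.linearExtend_sub_mem hle hφ) b ?_).le
  rw [not_le] at h
  simpa [coeff_mono, h.ne] using hb

/-! ### Triviality of compositions -/

theorem IsTrivialMod.of_isContext {S : Set (BracketedPoly k X)} {a : BracketedWord X}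
    {s : BracketedPoly k X} (hs : s ∈ S) {φ : BracketedWord X → BracketedWord X}
    (hφ : IsContext φ) (h : φ (leadingMonomial s) < a) :
    IsTrivialMod S a (linearExtend k φ s) := by
  obtain ⟨q, rfl⟩ := hφ.exists_plug
  exact Submodule.subset_span ⟨s, hs, q, h, rfl⟩

theorem IsTrivialMod.map_linearExtend (hle : IsMonomialOrder X) {S : Set (BracketedPoly k X)}
    {a : BracketedWord X} {f : BracketedPoly k X} (hf : IsTrivialMod S a f)
    {φ : BracketedWord X → BracketedWord X} (hφ : IsContext φ) :
    IsTrivialMod S (φ a) (linearExtend k φ f) := by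
  rw [IsTrivialMod] at hf
  induction hf using Submodule.span_induction with
  | mem g hg =>
    obtain ⟨s, hs, q, hq, rfl⟩ := hg
    rw [plug_eq, linearExtend_linearExtend]
    exact .of_isContext hs (hφ.comp (isContext_plug q)) (hle.strictMono hφ hq)
  | zero => rw [map_zero]; exact zero_mem _
  | add f g _ _ ihf ihg => rw [map_add]; exact add_mem ihf ihg
  | smul c f _ ih => rw [map_smul]; exact Submodule.smul_mem _ _ ih

theorem IsTrivialMod.sub_comm {S : Set (BracketedPoly k X)} {a : BracketedWord X}
    {f g : BracketedPoly k X} (h : IsTrivialMod S a (f - g)) : IsTrivialMod S a (g - f) := by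
  rw [← neg_sub]; exact neg_mem (S := Submodule k _) h

/-- Two disjoint occurrences of leading monomials give a trivial difference. -/
theorem isTrivialMod_of_disjoint (hle : IsMonomialOrder X) {S : Set (BracketedPoly k X)}
    (hS : ∀ s ∈ S, IsMonic s) {f g : BracketedPoly k X} (hf : f ∈ S) (hg : g ∈ S)
    {φ ψ : BracketedWord X → BracketedWord X} (hφ : IsContext φ) (hψ : IsContext ψ) :
    IsTrivialMod S (φ (leadingMonomial f) * ψ (leadingMonomial g))
      (linearExtend k (fun b => φ b * ψ (leadingMonomial g)) f -
        linearExtend k (fun b => φ (leadingMonomial f) * ψ b) g) := by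
  rw [← linearExtend_mul_mono, ← mono_mul_linearExtend]
  have hF := (hS f hf).linearExtend_sub_mem hle hφ
  have hG := (hS g hg).linearExtend_sub_mem hle hψ
  generalize hF' : linearExtend k φ f = F at hF ⊢
  generalize hG' : linearExtend k ψ g = G at hG ⊢
  generalize ha : φ (leadingMonomial f) = a at hF ⊢
  generalize hb : ψ (leadingMonomial g) = b at hG ⊢
  -- Both terms on the right carry a factor supported strictly below its leading word. Expanding
  -- that factor into words leaves contexts applied to `g` or `f`, with leading words below `a * b`.
  have e : F * mono k b - mono k a * G = (F - mono k a) * G - F * (G - mono k b) := by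
    noncomm_ring
  rw [e]
  generalize F - mono k a = F' at hF ⊢
  generalize G - mono k b = G' at hG ⊢
  subst hF' hG' ha hb
  refine sub_mem (S := Submodule k _) ?_ ?_
  · induction hF using Submodule.span_induction with
    | mem x hx =>
      obtain ⟨c, hc, rfl⟩ := hx
      rw [mono_mul_linearExtend]
      exact Submodule.subset_span <| by
        obtain ⟨q, hq⟩ := (hψ.mul_left c).exists_plug
        refine ⟨g, hg, q, ?_, by rw [plug_eq, hq]⟩
        rw [hq]
        exact hle.strictMono (.head _) hc
    | zero => simp
    | add x y _ _ ihx ihy => rw [add_mul]; exact add_mem ihx ihy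
    | smul c x _ ih => rw [smul_mul_assoc]; exact Submodule.smul_mem _ _ ih
  · induction hG using Submodule.span_induction with
    | mem x hx =>
      obtain ⟨c, hc, rfl⟩ := hx
      rw [linearExtend_mul_mono]
      exact Submodule.subset_span <| by
        obtain ⟨q, hq⟩ := (hφ.mul_right c).exists_plug
        refine ⟨f, hf, q, ?_, by rw [plug_eq, hq]⟩
        rw [hq]
        exact hle.strictMono (isContext_id.mul_left _) hc
    | zero => simp
    | add x y _ _ ihx ihy => rw [mul_add]; exact add_mem ihx ihy
    | smul c x _ ih => rw [mul_smul_comm]; exact Submodule.smul_mem _ _ ih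

theorem IsGroebnerShirshov.isTrivialMod_including {S : Set (BracketedPoly k X)}
    (hGS : IsGroebnerShirshov S) {f g : BracketedPoly k X} (hf : f ∈ S) (hg : g ∈ S)
    {φ : BracketedWord X → BracketedWord X} (hφ : IsContext φ)
    (h : leadingMonomial f = φ (leadingMonomial g)) :
    IsTrivialMod S (leadingMonomial f) (f - linearExtend k φ g) := by
  obtain ⟨q, rfl⟩ := hφ.exists_plug
  exact hGS.including f hf g hg _ q rfl h

/-- Case where `f̄` is a prefix of the common word. The occurrence of `ḡ` lies inside `f̄` (an
including composition), inside `r` (disjoint), or straddles the cut between them. -/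
theorem IsGroebnerShirshov.isTrivialMod_head (hle : IsMonomialOrder X)
    {S : Set (BracketedPoly k X)} (hS : ∀ s ∈ S, IsMonic s) (hGS : IsGroebnerShirshov S)
    {f g : BracketedPoly k X} (hf : f ∈ S) (hg : g ∈ S) {r : BracketedWord X}
    {ψ : BracketedWord X → BracketedWord X} (hψ : IsContext ψ)
    (h : ψ (leadingMonomial g) = leadingMonomial f * r) :
    IsTrivialMod S (leadingMonomial f * r)
      (linearExtend k (fun b => b * r) f - linearExtend k ψ g) := by
  rcases hψ.eq_mul_cases h with ⟨p, hp, hu, rfl⟩ | ⟨p, hp, rfl, rfl⟩ | ⟨n, m, b₁, b₂, hb, hn, rfl, rfl⟩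
  · have := (hGS.isTrivialMod_including hf hg hp hu).map_linearExtend hle (.head r)
    rwa [map_sub, linearExtend_linearExtend] at this
  · have := isTrivialMod_of_disjoint hle hS hf hg isContext_id hp
    exact this
  -- Here `f̄ = n b₁`, `ḡ = b₁ b₂` and `r = b₂ m`. An empty `b₁` means disjoint occurrences; an
  -- empty `b₂` or `n` means that one leading word contains the other. Otherwise `n b₁ b₂` is a
  -- genuine overlap, and nonemptiness of the three pieces gives the strict breadth bounds.
  · by_cases h₁ : b₁ = 1
    · subst h₁
      rw [one_mul] at hb
      rw [mul_one] at hn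
      subst hb
      rw [← hn]
      have := isTrivialMod_of_disjoint hle hS hf hg isContext_id (.head m)
      exact this
    by_cases h₂ : b₂ = 1
    · subst h₂
      rw [mul_one] at hb
      have := (hGS.isTrivialMod_including hf hg (isContext_id.mul_left n)
        (by rw [hn, hb])).map_linearExtend hle (.head m)
      rw [map_sub, linearExtend_linearExtend] at this
      simpa only [one_mul, mul_assoc] using this
    by_cases h₃ : n = 1
    · subst h₃
      rw [one_mul] at hn
      have := ((hGS.isTrivialMod_including hg hf (.head b₂)
        (by rw [hn, hb])).sub_comm).map_linearExtend hle (.head m)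
      rw [map_sub, linearExtend_linearExtend] at this
      simpa only [one_mul, mul_assoc, hb, hn] using this
    have p₁ := breadth_pos h₁
    have p₂ := breadth_pos h₂
    have p₃ := breadth_pos h₃
    have := (hGS.intersection f hf g hg (n * b₁ * b₂) b₂ n (by rw [hn]) (by rw [hb, mul_assoc])
      (by rw [hn, hb]; simp only [breadth_mul, max_lt_iff]; omega)
      (by rw [hn, hb]; simp only [breadth_mul]; omega)).map_linearExtend hle (.head m)
    rw [map_sub, ← linearExtend_id f, ← linearExtend_id g, linearExtend_mul_mono,
      mono_mul_linearExtend, linearExtend_linearExtend, linearExtend_linearExtend] at this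
    simpa only [mul_assoc, hn, linearExtend_id] using this

/-- In a Gröbner–Shirshov basis, two elements `q|_s` with the same leading monomial agree up to
terms of the same kind with smaller leading monomials. -/
theorem IsGroebnerShirshov.isTrivialMod_sub (hle : IsMonomialOrder X)
    {S : Set (BracketedPoly k X)} (hS : ∀ s ∈ S, IsMonic s) (hGS : IsGroebnerShirshov S)
    {f g : BracketedPoly k X} (hf : f ∈ S) (hg : g ∈ S)
    {φ ψ : BracketedWord X → BracketedWord X} (hφ : IsContext φ) (hψ : IsContext ψ)
    (h : φ (leadingMonomial f) = ψ (leadingMonomial g)) :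
    IsTrivialMod S (φ (leadingMonomial f)) (linearExtend k φ f - linearExtend k ψ g) := by
  have lift : ∀ {χ φ ψ : BracketedWord X → BracketedWord X}, IsContext χ →
      IsTrivialMod S (φ (leadingMonomial f)) (linearExtend k φ f - linearExtend k ψ g) →
      IsTrivialMod S (χ (φ (leadingMonomial f)))
        (linearExtend k (fun b => χ (φ b)) f - linearExtend k (fun b => χ (ψ b)) g) := by
    intro χ φ ψ hχ h
    have := h.map_linearExtend hle hχ
    rwa [map_sub, linearExtend_linearExtend, linearExtend_linearExtend] at this
  -- Outer layers common to both contexts are stripped and restored by `lift`. The paths end at a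
  -- `head`, or part where one enters a bracket and the other passes it, which makes the occurrences
  -- disjoint.
  induction hφ generalizing ψ with
  | head r => exact hGS.isTrivialMod_head hle hS hf hg hψ h.symm
  | @var x φ hφ ih =>
    cases hψ with
    | head r =>
      rw [h]
      exact (hGS.isTrivialMod_head hle hS hg hf (.var x hφ) h).sub_comm
    | var y hψ =>
      simp only [var.injEq] at h
      obtain ⟨rfl, h⟩ := h
      have := lift (.var x isContext_id) (ih hψ h)
      exact this
    | brInner r hψ => simp at h
    | brOuter a hψ => simp at h
  | @brInner r φ hφ ih =>
    cases hψ with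
    | head r' =>
      rw [h]
      exact (hGS.isTrivialMod_head hle hS hg hf (.brInner r hφ) h).sub_comm
    | var y hψ => simp at h
    | brInner r' hψ =>
      simp only [br.injEq] at h
      obtain ⟨h, rfl⟩ := h
      have := lift (.brInner r isContext_id) (ih hψ h)
      exact this
    | brOuter a hψ =>
      simp only [br.injEq] at h
      obtain ⟨rfl, rfl⟩ := h
      have := isTrivialMod_of_disjoint hle hS hf hg (.brInner 1 hφ) hψ
      exact this
  | @brOuter a φ hφ ih =>
    cases hψ with
    | head r' =>
      rw [h]
      exact (hGS.isTrivialMod_head hle hS hg hf (.brOuter a hφ) h).sub_comm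
    | var y hψ => simp at h
    | brInner r' hψ =>
      simp only [br.injEq] at h
      obtain ⟨rfl, rfl⟩ := h
      have := (isTrivialMod_of_disjoint hle hS hg hf (.brInner 1 hψ) hφ).sub_comm
      exact this
    | brOuter a' hψ =>
      simp only [br.injEq] at h
      obtain ⟨rfl, h⟩ := h
      have := lift (.brOuter a isContext_id) (ih hψ h)
      exact this

end BracketedPoly

/-! ### Rewriting: termination and normal forms -/

namespace BracketedPoly

open BracketedWord TermRewriting

variable {k : Type v} {X : Type u} [CommRing k] [LinearOrder (BracketedWord X)]

theorem mem_irr_iff {S : Set (BracketedPoly k X)} {a : BracketedWord X} :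
    a ∈ irr S ↔ ∀ s ∈ S, ∀ φ, IsContext φ → φ (leadingMonomial s) ≠ a := by
  refine ⟨fun h s hs φ hφ e => ?_, ?_⟩
  · obtain ⟨q, rfl⟩ := hφ.exists_plug
    exact h ⟨s, hs, q, e⟩
  · rintro h ⟨s, hs, q, e⟩
    exact h s hs _ (isContext_plug q) e

theorem mem_irrSpan {S : Set (BracketedPoly k X)} {f : BracketedPoly k X} :
    f ∈ irrSpan S ↔ ∀ a, f.coeff a ≠ 0 → a ∈ irr S := mem_span_mono_iff

/-- `Π_S` rewrites `f` by subtracting a multiple of some `q|_s`. -/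
theorem oneStep_iff {S : Set (BracketedPoly k X)} (hS : ∀ s ∈ S, IsMonic s)
    {f g : BracketedPoly k X} :
    OneStep (MonoidAlgebra.basis (BracketedWord X) k) (rewritingSystem S) f g ↔
      ∃ s ∈ S, ∃ φ, IsContext φ ∧ f.coeff (φ (leadingMonomial s)) ≠ 0 ∧
        g = f - f.coeff (φ (leadingMonomial s)) • linearExtend k φ s := by
  have key : ∀ s ∈ S, ∀ q : StarWord X, ∀ c : k,
      c • plug q (remainder s) - (c • mono k (q.plug (leadingMonomial s)) - f) =
        f - c • linearExtend k q.plug s := by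
    intro s hs q c
    rw [plug_eq, remainder, (hS s hs).2, one_smul, map_sub, linearExtend_mono, smul_sub]
    abel
  constructor
  · rintro ⟨t, v, ⟨s, hs, q, e⟩, h, rfl⟩
    obtain ⟨rfl, rfl⟩ := Prod.mk.inj e
    exact ⟨s, hs, _, isContext_plug q, h, key s hs q _⟩
  · rintro ⟨s, hs, φ, hφ, h, rfl⟩
    obtain ⟨q, rfl⟩ := hφ.exists_plug
    exact ⟨_, _, ⟨s, hs, q, rfl⟩, h, (key s hs q _).symm⟩

/-- Coefficient functions are compared at the largest word where they differ, a zero coefficient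
counting as smaller than a nonzero one. On `k` this relation has no chain of two steps, so nothing
is required of `k` itself. -/
theorem wellFounded_oneStep (hle : IsMonomialOrder X) {S : Set (BracketedPoly k X)}
    (hS : ∀ s ∈ S, IsMonic s) :
    WellFounded fun g f : BracketedPoly k X =>
      OneStep (MonoidAlgebra.basis (BracketedWord X) k) (rewritingSystem S) f g := by
  have hlex : WellFounded (Finsupp.Lex (fun a b : BracketedWord X => b < a)
      fun c d : k => c = 0 ∧ d ≠ 0) :=
    Finsupp.Lex.wellFounded' (fun _ h => h.2 rfl)
      ⟨fun d => ⟨_, fun _ hc => ⟨_, fun _ hb => absurd hc.1 hb.2⟩⟩⟩ hle.wellFounded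
  refine Subrelation.wf (fun {g f} h => ?_) (InvImage.wf MonoidAlgebra.coeff hlex)
  obtain ⟨s, hs, φ, hφ, hne, rfl⟩ := (oneStep_iff hS).1 h
  refine ⟨φ (leadingMonomial s), fun b hb => ?_, ?_, hne⟩
  · have : (linearExtend k φ s).coeff b = 0 := by
      by_contra h'
      exact not_lt.2 ((hS s hs).le_of_coeff_linearExtend_ne_zero hle hφ h') hb
    simp [this]
  · simp [(hS s hs).coeff_linearExtend_self hle hφ]

theorem terminating_rewritingSystem (hle : IsMonomialOrder X) {S : Set (BracketedPoly k X)}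
    (hS : ∀ s ∈ S, IsMonic s) :
    Terminating (MonoidAlgebra.basis (BracketedWord X) k) (rewritingSystem S) := by
  rintro ⟨f, hf⟩
  exact (wellFounded_iff_isEmpty_descending_chain.1 (wellFounded_oneStep hle hS)).false ⟨f, hf⟩

theorem exists_rewrites_mem_irrSpan (hle : IsMonomialOrder X) {S : Set (BracketedPoly k X)}
    (hS : ∀ s ∈ S, IsMonic s) (f : BracketedPoly k X) :
    ∃ g ∈ irrSpan S, Rewrites (MonoidAlgebra.basis (BracketedWord X) k) (rewritingSystem S) f g := by
  induction f using (wellFounded_oneStep hle hS).induction with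
  | _ f ih =>
  by_cases hf : f ∈ irrSpan S
  · exact ⟨f, hf, .refl⟩
  simp only [mem_irrSpan, mem_irr_iff] at hf
  push Not at hf
  obtain ⟨_, ha, s, hs, φ, hφ, rfl⟩ := hf
  have h := (oneStep_iff hS).2 ⟨s, hs, φ, hφ, ha, rfl⟩
  obtain ⟨g, hg, hr⟩ := ih _ h
  exact ⟨g, hg, .head h hr⟩

theorem sub_mem_operatedIdeal_of_rewrites {S : Set (BracketedPoly k X)}
    (hS : ∀ s ∈ S, IsMonic s) {f g : BracketedPoly k X}
    (h : Rewrites (MonoidAlgebra.basis (BracketedWord X) k) (rewritingSystem S) f g) :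
    f - g ∈ operatedIdeal S := by
  induction h with
  | refl => simp
  | @tail g g' _ h ih =>
    obtain ⟨s, hs, φ, hφ, -, rfl⟩ := (oneStep_iff hS).1 h
    rw [← sub_add]
    refine add_mem ih (Submodule.smul_mem _ _ ?_)
    rw [operatedIdeal_eq_span]
    exact Submodule.subset_span ⟨s, hs, φ, hφ, rfl⟩

theorem IsTrivialMod.mem_operatedIdeal {S : Set (BracketedPoly k X)} {a : BracketedWord X}
    {f : BracketedPoly k X} (h : IsTrivialMod S a f) : f ∈ operatedIdeal S := by
  rw [operatedIdeal_eq_span]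
  refine Submodule.span_mono ?_ h
  rintro _ ⟨s, hs, q, -, rfl⟩
  exact ⟨s, hs, _, isContext_plug q, rfl⟩

theorem IsTrivialMod.mem_lowerSpan (hle : IsMonomialOrder X) {S : Set (BracketedPoly k X)}
    (hS : ∀ s ∈ S, IsMonic s) {a : BracketedWord X} {f : BracketedPoly k X}
    (h : IsTrivialMod S a f) : f ∈ lowerSpan k a := by
  refine Submodule.span_le.2 ?_ h
  rintro _ ⟨s, hs, q, hq, rfl⟩
  exact BracketedPoly.mem_lowerSpan.2 fun b hb =>
    ((hS s hs).le_of_coeff_linearExtend_ne_zero hle (isContext_plug q) hb).trans_lt hq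

/-- Each step subtracts a multiple of some `q|_s` whose leading word occurs in the current element,
hence lies below `a`; what remains is still supported below `a`. -/
theorem isTrivialMod_sub_of_rewrites (hle : IsMonomialOrder X) {S : Set (BracketedPoly k X)}
    (hS : ∀ s ∈ S, IsMonic s) {a : BracketedWord X} {f g : BracketedPoly k X}
    (h : Rewrites (MonoidAlgebra.basis (BracketedWord X) k) (rewritingSystem S) f g)
    (hf : f ∈ lowerSpan k a) : IsTrivialMod S a (f - g) := by
  induction h with
  | refl => rw [sub_self]; exact zero_mem (Submodule.span k _)
  | @tail g g' _ h ih =>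
    obtain ⟨s, hs, φ, hφ, hne, rfl⟩ := (oneStep_iff hS).1 h
    have hg : g ∈ lowerSpan k a := by
      simpa using sub_mem hf (ih.mem_lowerSpan hle hS)
    rw [← sub_add]
    exact add_mem (S := Submodule k _) ih
      (Submodule.smul_mem _ _ (IsTrivialMod.of_isContext hs hφ (BracketedPoly.mem_lowerSpan.1 hg _ hne)))

theorem eq_of_rewrites_of_mem_irrSpan {S : Set (BracketedPoly k X)}
    (hS : ∀ s ∈ S, IsMonic s) {f g : BracketedPoly k X}
    (h : Rewrites (MonoidAlgebra.basis (BracketedWord X) k) (rewritingSystem S) f g)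
    (hf : f ∈ irrSpan S) : g = f := by
  induction h with
  | refl => rfl
  | tail _ h ih =>
    subst ih
    obtain ⟨s, hs, φ, hφ, hne, -⟩ := (oneStep_iff hS).1 h
    exact absurd rfl (mem_irr_iff.1 (mem_irrSpan.1 hf _ hne) s hs φ hφ)

/-- The leading word has coefficient `1` in `φ(s)`, so clearing it from either element, in at most
one step, gives the same result. -/
theorem joinable_add_smul (hle : IsMonomialOrder X) {S : Set (BracketedPoly k X)}
    (hS : ∀ s ∈ S, IsMonic s) {s : BracketedPoly k X} (hs : s ∈ S)
    {φ : BracketedWord X → BracketedWord X} (hφ : IsContext φ) (c : k) (f : BracketedPoly k X) :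
    Joinable (MonoidAlgebra.basis (BracketedWord X) k) (rewritingSystem S)
      (f + c • linearExtend k φ s) f := by
  have reduct : ∀ g : BracketedPoly k X,
      Rewrites (MonoidAlgebra.basis (BracketedWord X) k) (rewritingSystem S) g
        (g - g.coeff (φ (leadingMonomial s)) • linearExtend k φ s) := by
    intro g
    by_cases h : g.coeff (φ (leadingMonomial s)) = 0
    · rw [h, zero_smul, sub_zero]; exact .refl
    · exact .single ((oneStep_iff hS).2 ⟨s, hs, φ, hφ, h, rfl⟩)
  refine ⟨_, ?_, reduct f⟩
  have h := reduct (f + c • linearExtend k φ s)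
  rwa [MonoidAlgebra.coeff_add, Finsupp.add_apply, MonoidAlgebra.coeff_smul_apply,
    (hS s hs).coeff_linearExtend_self hle hφ, smul_eq_mul, mul_one, add_smul,
    add_sub_add_right_eq_sub] at h

omit [LinearOrder (BracketedWord X)] in
theorem joinable_trans_of_confluent {P : Set (BracketedWord X × BracketedPoly k X)}
    (hP : Confluent (MonoidAlgebra.basis (BracketedWord X) k) P) {f g h : BracketedPoly k X}
    (hfg : Joinable (MonoidAlgebra.basis (BracketedWord X) k) P f g)
    (hgh : Joinable (MonoidAlgebra.basis (BracketedWord X) k) P g h) :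
    Joinable (MonoidAlgebra.basis (BracketedWord X) k) P f h := by
  obtain ⟨a, hfa, hga⟩ := hfg
  obtain ⟨b, hgb, hhb⟩ := hgh
  obtain ⟨c, hac, hbc⟩ := hP g a b hga hgb
  exact ⟨c, hfa.trans hac, hhb.trans hbc⟩

/-! ### Consequences and equivalents of trivial intersection -/

theorem inf_eq_bot_of_confluent (hle : IsMonomialOrder X) {S : Set (BracketedPoly k X)}
    (hS : ∀ s ∈ S, IsMonic s)
    (hP : Confluent (MonoidAlgebra.basis (BracketedWord X) k) (rewritingSystem S)) :
    operatedIdeal S ⊓ irrSpan S = ⊥ := by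
  -- Quantifying over `c` and `g` lets the span induction absorb scalars and chain sums by
  -- transitivity.
  have key : ∀ f ∈ operatedIdeal S, ∀ (c : k) (g : BracketedPoly k X),
      Joinable (MonoidAlgebra.basis (BracketedWord X) k) (rewritingSystem S) (g + c • f) g := by
    intro f hf
    rw [operatedIdeal_eq_span] at hf
    induction hf using Submodule.span_induction with
    | mem f hf =>
      obtain ⟨s, hs, φ, hφ, rfl⟩ := hf
      exact joinable_add_smul hle hS hs hφ
    | zero => exact fun c g => ⟨g, by rw [smul_zero, add_zero]; exact .refl, .refl⟩
    | add f f' _ _ ihf ihf' =>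
      intro c g
      rw [smul_add, ← add_assoc]
      exact joinable_trans_of_confluent hP (ihf' c _) (ihf c g)
    | smul d f _ ih => intro c g; rw [smul_smul]; exact ih _ g
  rw [eq_bot_iff]
  rintro f ⟨hf, hf'⟩
  obtain ⟨h, h₁, h₂⟩ := key f hf 1 0
  rw [zero_add, one_smul] at h₁
  rw [Submodule.mem_bot, ← eq_of_rewrites_of_mem_irrSpan hS h₁ hf',
    eq_of_rewrites_of_mem_irrSpan hS h₂ (zero_mem _)]

theorem confluent_of_inf_eq_bot (hle : IsMonomialOrder X) {S : Set (BracketedPoly k X)}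
    (hS : ∀ s ∈ S, IsMonic s) (h : operatedIdeal S ⊓ irrSpan S = ⊥) :
    Confluent (MonoidAlgebra.basis (BracketedWord X) k) (rewritingSystem S) := by
  intro f g g' hg hg'
  obtain ⟨n, hn, hgn⟩ := exists_rewrites_mem_irrSpan hle hS g
  obtain ⟨n', hn', hgn'⟩ := exists_rewrites_mem_irrSpan hle hS g'
  have hmem : n' - n ∈ operatedIdeal S ⊓ irrSpan S := by
    refine ⟨?_, sub_mem hn' hn⟩
    have := sub_mem (sub_mem_operatedIdeal_of_rewrites hS (hg.trans hgn))
      (sub_mem_operatedIdeal_of_rewrites hS (hg'.trans hgn'))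
    rwa [sub_sub_sub_cancel_left] at this
  rw [h, Submodule.mem_bot, sub_eq_zero] at hmem
  exact ⟨n, hgn, hmem ▸ hgn'⟩

theorem isCompl_of_inf_eq_bot (hle : IsMonomialOrder X) {S : Set (BracketedPoly k X)}
    (hS : ∀ s ∈ S, IsMonic s) (h : operatedIdeal S ⊓ irrSpan S = ⊥) :
    IsCompl (operatedIdeal S) (irrSpan S) := by
  refine ⟨disjoint_iff.2 h, codisjoint_iff.2 (eq_top_iff.2 fun f _ => ?_)⟩
  obtain ⟨g, hg, hr⟩ := exists_rewrites_mem_irrSpan hle hS f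
  exact Submodule.mem_sup.2
    ⟨_, sub_mem_operatedIdeal_of_rewrites hS hr, g, hg, sub_add_cancel f g⟩

/-- The normal form of `f` lies in the intersection, so `f` rewrites to `0`, and the rewriting
itself is the required expression. -/
theorem isTrivialMod_of_inf_eq_bot (hle : IsMonomialOrder X) {S : Set (BracketedPoly k X)}
    (hS : ∀ s ∈ S, IsMonic s) (h : operatedIdeal S ⊓ irrSpan S = ⊥) {a : BracketedWord X}
    {f : BracketedPoly k X} (hf : f ∈ operatedIdeal S) (ha : f ∈ lowerSpan k a) :
    IsTrivialMod S a f := by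
  obtain ⟨g, hg, hr⟩ := exists_rewrites_mem_irrSpan hle hS f
  have hmem : g ∈ operatedIdeal S ⊓ irrSpan S :=
    ⟨by simpa using sub_mem hf (sub_mem_operatedIdeal_of_rewrites hS hr), hg⟩
  rw [h, Submodule.mem_bot] at hmem
  simpa [hmem] using isTrivialMod_sub_of_rewrites hle hS hr ha

theorem isGroebnerShirshov_of_inf_eq_bot (hle : IsMonomialOrder X) {S : Set (BracketedPoly k X)}
    (hS : ∀ s ∈ S, IsMonic s) (h : operatedIdeal S ⊓ irrSpan S = ⊥) : IsGroebnerShirshov S := by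
  -- Both kinds of composition have this shape; the two leading terms are equal with coefficient `1`
  -- and cancel.
  have key : ∀ f ∈ S, ∀ g ∈ S, ∀ φ ψ : BracketedWord X → BracketedWord X, IsContext φ →
      IsContext ψ → φ (leadingMonomial f) = ψ (leadingMonomial g) →
      IsTrivialMod S (φ (leadingMonomial f)) (linearExtend k φ f - linearExtend k ψ g) := by
    intro f hf g hg φ ψ hφ hψ e
    have mem : ∀ s ∈ S, ∀ χ, IsContext χ → linearExtend k χ s ∈ operatedIdeal S := fun s hs χ hχ =>
      linearExtend_mem_of_isOperatedIdeal (isLeast_operatedIdeal S).1.1 hχ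
        ((isLeast_operatedIdeal S).1.2 hs)
    refine isTrivialMod_of_inf_eq_bot hle hS h (sub_mem (mem f hf φ hφ) (mem g hg ψ hψ)) ?_
    have h₁ := (hS f hf).linearExtend_sub_mem hle hφ
    have h₂ := (hS g hg).linearExtend_sub_mem hle hψ
    rw [← e] at h₂
    simpa using sub_mem h₁ h₂
  refine ⟨fun f hf g hg a m n hm hn _ _ => ?_, fun f hf g hg a q ha hq => ?_⟩
  · have := key f hf g hg _ _ (.head m) (isContext_id.mul_left n) (hm.symm.trans hn)
    rw [← linearExtend_mul_mono (fun b => b), ← mono_mul_linearExtend (fun b => b),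
      linearExtend_id, linearExtend_id, ← hm] at this
    exact this
  · have := key f hf g hg _ _ isContext_id (isContext_plug q) (ha.symm.trans hq)
    rw [linearExtend_id, ← ha] at this
    exact this

/-! ### The Composition-Diamond lemma -/

/-- The span of the elements `q|_s` with `s ∈ S` and `q|_{s̄} ∈ A`. -/
noncomputable def plugSpan (S : Set (BracketedPoly k X)) (A : Set (BracketedWord X)) :
    Submodule k (BracketedPoly k X) :=
  Submodule.span k
    {g | ∃ s ∈ S, ∃ φ, IsContext φ ∧ φ (leadingMonomial s) ∈ A ∧ g = linearExtend k φ s}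

theorem plugSpan_mono {S : Set (BracketedPoly k X)} {A B : Set (BracketedWord X)} (h : A ⊆ B) :
    plugSpan S A ≤ plugSpan S B := by
  refine Submodule.span_mono ?_
  rintro _ ⟨s, hs, φ, hφ, ha, rfl⟩
  exact ⟨s, hs, φ, hφ, h ha, rfl⟩

theorem isTrivialMod_iff {S : Set (BracketedPoly k X)} {a : BracketedWord X}
    {f : BracketedPoly k X} : IsTrivialMod S a f ↔ f ∈ plugSpan S (Set.Iio a) := by
  refine ⟨fun h => Submodule.span_mono ?_ h, fun h => Submodule.span_le.2 ?_ h⟩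
  · rintro _ ⟨s, hs, q, hq, rfl⟩
    exact ⟨s, hs, _, isContext_plug q, hq, rfl⟩
  · rintro _ ⟨s, hs, φ, hφ, h, rfl⟩
    exact IsTrivialMod.of_isContext hs hφ h

/-- Only finitely many generators occur, so the largest of their leading words serves as `b`. With
`A = Set.Iio a` this turns triviality modulo `a` into a bound strictly below `a`. -/
theorem eq_zero_or_exists_mem_plugSpan_Iic {S : Set (BracketedPoly k X)}
    {A : Set (BracketedWord X)} {f : BracketedPoly k X} (h : f ∈ plugSpan S A) :
    f = 0 ∨ ∃ b ∈ A, f ∈ plugSpan S (Set.Iic b) := by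
  rw [plugSpan] at h
  induction h using Submodule.span_induction with
  | mem g hg =>
    obtain ⟨s, hs, φ, hφ, ha, rfl⟩ := hg
    exact Or.inr ⟨_, ha, Submodule.subset_span ⟨s, hs, φ, hφ, le_rfl, rfl⟩⟩
  | zero => exact Or.inl rfl
  | add f g _ _ ihf ihg =>
    rcases ihf with rfl | ⟨b, hb, hf⟩
    · rwa [zero_add]
    rcases ihg with rfl | ⟨c, hc, hg⟩
    · rw [add_zero]; exact Or.inr ⟨b, hb, hf⟩
    · rcases le_total b c with hbc | hbc
      · exact Or.inr ⟨c, hc, add_mem (plugSpan_mono (Set.Iic_subset_Iic.2 hbc) hf) hg⟩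
      · exact Or.inr ⟨b, hb, add_mem hf (plugSpan_mono (Set.Iic_subset_Iic.2 hbc) hg)⟩
  | smul c f _ ih =>
    rcases ih with rfl | ⟨b, hb, hf⟩
    · rw [smul_zero]; exact Or.inl rfl
    · exact Or.inr ⟨b, hb, Submodule.smul_mem _ _ hf⟩

/-- An element of the span of the `q|_s` with leading monomial at most `a` is, up to one multiple
of a single such element with leading monomial `a`, trivial modulo `(S, a)`. -/
theorem IsGroebnerShirshov.exists_sub_smul_isTrivialMod (hle : IsMonomialOrder X)
    {S : Set (BracketedPoly k X)} (hS : ∀ s ∈ S, IsMonic s) (hGS : IsGroebnerShirshov S)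
    {s : BracketedPoly k X} (hs : s ∈ S) {φ : BracketedWord X → BracketedWord X}
    (hφ : IsContext φ) {f : BracketedPoly k X}
    (hf : f ∈ plugSpan S (Set.Iic (φ (leadingMonomial s)))) :
    ∃ c : k, IsTrivialMod S (φ (leadingMonomial s)) (f - c • linearExtend k φ s) := by
  rw [plugSpan] at hf
  induction hf using Submodule.span_induction with
  | mem g hg =>
    obtain ⟨t, ht, ψ, hψ, h, rfl⟩ := hg
    rcases lt_or_eq_of_le h with h | h
    · exact ⟨0, by rw [zero_smul, sub_zero]; exact .of_isContext ht hψ h⟩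
    · exact ⟨1, by rw [one_smul, ← h]; exact hGS.isTrivialMod_sub hle hS ht hs hψ hφ h⟩
  | zero => exact ⟨0, by rw [zero_smul, sub_zero]; exact zero_mem (Submodule.span k _)⟩
  | add f g _ _ ihf ihg =>
    obtain ⟨c, hc⟩ := ihf
    obtain ⟨d, hd⟩ := ihg
    refine ⟨c + d, ?_⟩
    rw [add_smul, add_sub_add_comm]
    exact add_mem (S := Submodule k _) hc hd
  | smul d f _ ih =>
    obtain ⟨c, hc⟩ := ih
    refine ⟨d * c, ?_⟩
    rw [mul_smul, ← smul_sub]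
    exact Submodule.smul_mem _ d hc

/-- The Composition-Diamond lemma. -/
theorem IsGroebnerShirshov.inf_eq_bot (hle : IsMonomialOrder X)
    {S : Set (BracketedPoly k X)} (hS : ∀ s ∈ S, IsMonic s) (hGS : IsGroebnerShirshov S) :
    operatedIdeal S ⊓ irrSpan S = ⊥ := by
  have key : ∀ (b : BracketedWord X) (f : BracketedPoly k X), f ∈ irrSpan S →
      f ∈ plugSpan S (Set.Iic b) → f = 0 := by
    intro b
    induction b using hle.wellFounded.induction with
    | _ b ih =>
    intro f hirr hf
    -- If `b` is irreducible, no generator has leading word `b`. If not, all generators led by `b`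
    -- are first merged into one multiple `c • φ(s)`.
    have htriv : IsTrivialMod S b f := by
      by_cases hred : b ∈ irr S
      · refine Submodule.span_le.2 ?_ hf
        rintro _ ⟨s, hs, φ, hφ, h, rfl⟩
        exact IsTrivialMod.of_isContext hs hφ
          (lt_of_le_of_ne h (mem_irr_iff.1 hred s hs φ hφ))
      · have hcoeff : f.coeff b = 0 := by
          by_contra h
          exact hred (mem_irrSpan.1 hirr b h)
        rw [mem_irr_iff] at hred
        push Not at hred
        obtain ⟨s, hs, φ, hφ, rfl⟩ := hred
        obtain ⟨c, hc⟩ := hGS.exists_sub_smul_isTrivialMod hle hS hs hφ hf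
        -- The word `b` has coefficient `0` in the irreducible `f` and in the trivial remainder, but
        -- `1` in `φ(s)`.
        have hc0 : c = 0 := by
          by_contra h
          refine lt_irrefl _ (BracketedPoly.mem_lowerSpan.1 (hc.mem_lowerSpan hle hS)
            (φ (leadingMonomial s)) ?_)
          simpa [hcoeff, (hS s hs).coeff_linearExtend_self hle hφ] using h
        simpa [hc0] using hc
    obtain rfl | ⟨c, hc, hf⟩ := eq_zero_or_exists_mem_plugSpan_Iic (isTrivialMod_iff.1 htriv)
    · rfl
    · exact ih c hc f hirr hf
  rw [eq_bot_iff]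
  rintro f ⟨hf, hirr⟩
  rw [operatedIdeal_eq_span] at hf
  have hf' : f ∈ plugSpan S Set.univ := by
    refine Submodule.span_mono ?_ hf
    rintro _ ⟨s, hs, φ, hφ, rfl⟩
    exact ⟨s, hs, φ, hφ, trivial, rfl⟩
  obtain rfl | ⟨b, -, hf'⟩ := eq_zero_or_exists_mem_plugSpan_Iic hf'
  · exact zero_mem _
  · exact key b f hirr hf'

end BracketedPoly

theorem mainTheorem3 {k : Type v} {X : Type u} [CommRing k] [IsDomain k] [Nonempty X]
    [LinearOrder (BracketedWord X)] (hle : IsMonomialOrder X)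
    (S : Set (BracketedPoly k X)) (hS : ∀ s ∈ S, BracketedPoly.IsMonic s) :
    List.TFAE
      [TermRewriting.Convergent (MonoidAlgebra.basis (BracketedWord X) k)
         (BracketedPoly.rewritingSystem S),
       TermRewriting.Confluent (MonoidAlgebra.basis (BracketedWord X) k)
         (BracketedPoly.rewritingSystem S),
       BracketedPoly.operatedIdeal S ⊓ BracketedPoly.irrSpan S = ⊥,
       IsCompl (BracketedPoly.operatedIdeal S) (BracketedPoly.irrSpan S),
       BracketedPoly.IsGroebnerShirshov S] := by
  tfae_have 1 → 2 := fun h => h.2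
  tfae_have 2 → 3 := BracketedPoly.inf_eq_bot_of_confluent hle hS
  tfae_have 3 → 1 := fun h => ⟨BracketedPoly.terminating_rewritingSystem hle hS,
    BracketedPoly.confluent_of_inf_eq_bot hle hS h⟩
  tfae_have 3 → 4 := BracketedPoly.isCompl_of_inf_eq_bot hle hS
  tfae_have 4 → 3 := fun h => h.inf_eq_bot
  tfae_have 3 → 5 := BracketedPoly.isGroebnerShirshov_of_inf_eq_bot hle hS
  tfae_have 5 → 3 := fun h => h.inf_eq_bot hle hS
  tfae_finish
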